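/- Let $E$ be a nonempty Polish space and let $X=(X_t)_{t\ge 0}$ be a time-homogeneous Markov process with càdlàg paths in $E$ (for instance a Feller process), with law $\mathbb P_x$ on the space of càdlàg paths when started in $x\in E$, and with semigroup $S_tf(x)=\mathbb E_x f(X_t)$. For $f:E\to\mathbb R$ let $\|f\|_{osc}=\sup_{x,y\in E}(f(x)-f(y))$, and let $$\|S_t\|_{osc}=\sup\{\|S_tf\|_{osc} : f \text{ bounded Borel},\ \|f\|_{osc}\le 1\}.$$ For all $x,y\in E$ let $\widehat{\mathbb P}_{x,y}$ be a coupling of $\mathbb P_x$ and $\mathbb P_y$, that is, a law of a pair of paths $(X^1,X^2)$ whose marginals are $\mathbb P_x$ and $\mathbb P_y$. Let $\tau=\inf\{t\ge 0 : X^1_s=X^2_s\ \forall s\ge t\}\in[0,\infty]$ be the coupling time, and suppose that $M:=\sup_{x,y\in E}\widehat{\mathbb E}_{x,y}\tau<\infty$. Then (with $\log 0=-\infty$ and $-\frac1M=-\infty$ if $M=0$) the limit below exists in $[-\infty,\infty]$ and $$\lim_{t\to\infty}\frac1t\log\|S_t\|_{osc}\le-\frac1M .$$ Moreover, the process has exactly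 one stationary probability distribution $\mu$, and for every bounded Borel function $f$ $$\limsup_{t\to\infty}\frac1t\log\|S_tf-\mu(f)\|_\infty\le-\frac1M ,$$ where $\|\cdot\|_\infty$ is the supremum norm; the same holds for every $f\in L^\infty(\mu)$ with the norm of $L^\infty(\mu)$. -/

import Mathlib

open MeasureTheory ProbabilityTheory Filter Topology
open scoped NNReal ENNReal

namespace UniformCoupling

/-- A trajectory `[0, ∞) → E` is càdlàg: right-continuous with left limits. At time `0` the filter
`𝓝[<] 0` in `ℝ≥0` is trivial, so the left limit is only asked for at positive times. -/
def IsCadlag {E : Type*} [TopologicalSpace E] (ω : ℝ≥0 → E) : Prop :=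
  ∀ t : ℝ≥0, ContinuousWithinAt ω (Set.Ici t) t ∧ ∃ l : E, Tendsto ω (𝓝[<] t) (𝓝 l)

/-- The space `D_{[0,∞)}(E)` of càdlàg trajectories. -/
abbrev CadlagPath (E : Type*) [TopologicalSpace E] : Type _ := {ω : ℝ≥0 → E // IsCadlag ω}

/-- The coordinate process `X_t`. The measurable structure on `CadlagPath E` is the one that
subtypes of the product space carry: it is generated by the coordinates. -/
def coord {E : Type*} [TopologicalSpace E] (t : ℝ≥0) (ω : CadlagPath E) : E := ω.1 t

theorem measurable_coord {E : Type*} [TopologicalSpace E] [MeasurableSpace E] (t : ℝ≥0) :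
    Measurable (coord t : CadlagPath E → E) :=
  (measurable_pi_apply t).comp measurable_subtype_coe

/-- The canonical filtration `F_t = σ(X_s : 0 ≤ s ≤ t)`. -/
def canonicalFiltration (E : Type*) [TopologicalSpace E] [MeasurableSpace E] :
    Filtration ℝ≥0 (inferInstance : MeasurableSpace (CadlagPath E)) where
  seq t := ⨆ s : Set.Iic t, MeasurableSpace.comap (coord (s : ℝ≥0)) inferInstance
  mono' := fun _ _ hst => iSup_le fun r =>
    le_iSup_of_le (⟨r.1, le_trans r.2 hst⟩ : Set.Iic _) le_rfl
  le' := fun _ => iSup_le fun r => (measurable_coord (r : ℝ≥0)).comap_le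

/-- The transition kernels `δ_x S_t`: the law of `X_t` under `P_x`. -/
noncomputable def transition {E : Type*} [TopologicalSpace E] [MeasurableSpace E]
    (P : Kernel E (CadlagPath E)) (t : ℝ≥0) : Kernel E E :=
  P.map (coord t)

/-- The family of laws `(P_x)` on càdlàg trajectories is a time-homogeneous Markov process: under
`P_x` the process starts in `x`, and `P_x(X_{s+t} ∈ A | F_s) = P_{X_s}(X_t ∈ A)` almost surely. -/
structure IsMarkovProcess {E : Type*} [TopologicalSpace E] [MeasurableSpace E]
    (P : Kernel E (CadlagPath E)) : Prop where
  isProbabilityMeasure : ∀ x, IsProbabilityMeasure (P x)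
  start : ∀ x, ∀ᵐ ω ∂(P x), coord 0 ω = x
  markov : ∀ (x : E) (s t : ℝ≥0) (A : Set E), MeasurableSet A →
    (P x)⟦coord (s + t) ⁻¹' A | canonicalFiltration E s⟧
      =ᵐ[P x] fun ω => (transition P t (coord s ω)).real A

/-- The semigroup `(S_t f)(x) = E_x f(X_t)`. -/
noncomputable def semigroup {E : Type*} [TopologicalSpace E] [MeasurableSpace E]
    (P : Kernel E (CadlagPath E)) (t : ℝ≥0) (f : E → ℝ) (x : E) : ℝ :=
  ∫ ω, f (coord t ω) ∂(P x)

/-- The oscillation seminorm `sup_{x,y} (f x - f y)`; taking `x = y` shows that truncating the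
differences at `0` does not change the supremum. -/
noncomputable def oscNorm {E : Type*} (f : E → ℝ) : ℝ≥0∞ :=
  ⨆ (x : E) (y : E), ENNReal.ofReal (f x - f y)

/-- The operator seminorm `‖S_t‖_osc` on Borel functions of finite oscillation, that is, on
bounded Borel functions. -/
noncomputable def semigroupOscNorm {E : Type*} [TopologicalSpace E] [MeasurableSpace E]
    (P : Kernel E (CadlagPath E)) (t : ℝ≥0) : ℝ≥0∞ :=
  ⨆ (f : E → ℝ) (_ : Measurable f) (_ : oscNorm f ≤ 1), oscNorm (semigroup P t f)

/-- The supremum norm. -/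
noncomputable def supNorm {E : Type*} (f : E → ℝ) : ℝ≥0∞ := ⨆ x : E, ‖f x‖ₑ

/-- `Q x y` is, for all `x` and `y`, a coupling of the process started in `x` and in `y`. -/
def IsCoupling {E : Type*} [TopologicalSpace E] [MeasurableSpace E]
    (P : Kernel E (CadlagPath E)) (Q : E → E → Measure (CadlagPath E × CadlagPath E)) : Prop :=
  ∀ x y, (Q x y).map Prod.fst = P x ∧ (Q x y).map Prod.snd = P y

/-- The coupling time `τ = inf {t ≥ 0 | X¹_s = X²_s for all s ≥ t}`, equal to `∞` if there is no
such `t`. -/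
noncomputable def couplingTime {E : Type*} [TopologicalSpace E]
    (ω : CadlagPath E × CadlagPath E) : ℝ≥0∞ :=
  ⨅ (t : ℝ≥0) (_ : ∀ s, t ≤ s → coord s ω.1 = coord s ω.2), (t : ℝ≥0∞)

/-- `M = sup_{x,y} Ê_{x,y} τ`. -/
noncomputable def maxMeanCouplingTime {E : Type*} [TopologicalSpace E] [MeasurableSpace E]
    (Q : E → E → Measure (CadlagPath E × CadlagPath E)) : ℝ≥0∞ :=
  ⨆ (x : E) (y : E), ∫⁻ ω, couplingTime ω ∂(Q x y)

/-- `μ` is a stationary probability distribution of the process: `μ S_t = μ` for all `t`. -/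
def IsStationary {E : Type*} [TopologicalSpace E] [MeasurableSpace E]
    (P : Kernel E (CadlagPath E)) (μ : Measure E) : Prop :=
  IsProbabilityMeasure μ ∧ ∀ t : ℝ≥0, μ.bind (transition P t) = μ

/-- `(1/t) log a`, with `log 0 = -∞`. -/
noncomputable def logRate (t : ℝ≥0) (a : ℝ≥0∞) : EReal := (((t : ℝ)⁻¹ : ℝ) : EReal) * ENNReal.log a

end UniformCoupling

namespace UniformCoupling

/-! ### Exponential rates -/

/-! Fix x, y and let δ(t) be the largest difference of means under δ_x S_t and δ_y S_t over Borel
functions of oscillation at most 1. The heart is the inequality ∫_s^∞ δ(t) dt ≤ M δ(s). To see it,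
pick a nearly optimal f_u for each time s + u and put g = ∫ S_u f_u du. By coupling, S_u f_u(a) -
S_u f_u(b) is at most the probability that the paths from a and b differ at time u, so the
oscillation of g is at most sup E τ ≤ M. Since S_s g = ∫ S_{s+u} f_u du, testing δ(s) with g / M
gives the claim. Applying f only at the end would bound δ by a Markov tail 1/t; feeding the
inequality back into itself at every s gives the rate 1/M.

The inequality is used through Riemann sums (`IsCoupling.sum_oscDist_le`), which need only finitely
many f_u. A discrete Gronwall argument (`sum_tail_le`), letting the mesh tend to 0, turns it into
exponential decay with the exact rate (`le_mul_exp_of_riemann_sum_le`). The limit exists because the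
oscillation norm is submultiplicative and at most 1.

For stationarity, δ_x S_n is Cauchy in total variation, hence has a limit μ, which is invariant. As
μ(f) = μ(S_t f), the error S_t f - μ(f) is at most the oscillation of S_t f and inherits the rate.
-/

theorem logRate_le_coe_iff {t : ℝ≥0} (ht : 0 < t) {c : ℝ} {a : ℝ≥0∞} :
    logRate t a ≤ c ↔ a ≤ ENNReal.ofReal (Real.exp (c * t)) := by
  have ht' : (0 : ℝ) < t := ht
  have hc : (c : EReal) = ENNReal.log (ENNReal.ofReal (Real.exp c)) := by
    rw [ENNReal.log_ofReal_of_pos (Real.exp_pos c), Real.log_exp]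
  rw [logRate, ← ENNReal.log_rpow, hc, ENNReal.log_le_log_iff, ENNReal.rpow_inv_le_iff ht',
    ENNReal.ofReal_rpow_of_pos (Real.exp_pos c), ← Real.exp_mul]

/-- For any z > c the prefactor is absorbed as soon as log C ≤ (z - c) t. -/
theorem limsup_logRate_le {b : ℝ≥0 → ℝ≥0∞} {C c : ℝ} (hC : 0 < C)
    (h : ∀ᶠ t : ℝ≥0 in atTop, b t ≤ ENNReal.ofReal (C * Real.exp (c * t))) :
    limsup (fun t => logRate t (b t)) atTop ≤ c := by
  rw [← EReal.le_of_forall_lt_iff_le]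
  intro z hz
  have hz' : 0 < z - c := sub_pos.2 (EReal.coe_lt_coe_iff.1 hz)
  refine limsup_le_of_le (by isBoundedDefault) ?_
  have hlarge : ∀ᶠ t : ℝ≥0 in atTop, Real.log C / (z - c) ≤ t :=
    NNReal.tendsto_coe_atTop.2 tendsto_id |>.eventually_ge_atTop _
  filter_upwards [h, hlarge, eventually_gt_atTop 0] with t h1 h2 h3
  rw [logRate_le_coe_iff h3]
  refine h1.trans (ENNReal.ofReal_le_ofReal ?_)
  rw [div_le_iff₀ hz'] at h2
  calc C * Real.exp (c * t) = Real.exp (Real.log C + c * t) := by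
        rw [Real.exp_add, Real.exp_log hC]
    _ ≤ Real.exp (z * t) := Real.exp_le_exp.2 (by linarith)

theorem pow_le_of_submultiplicative {a : ℝ≥0 → ℝ≥0∞} (h1 : ∀ t, a t ≤ 1)
    (hmul : ∀ s t, a (s + t) ≤ a s * a t) (s r : ℝ≥0) (n : ℕ) : a (n * s + r) ≤ a s ^ n := by
  induction n with
  | zero => simpa using h1 r
  | succ n ih =>
    calc a ((n + 1 : ℕ) * s + r) = a (s + (n * s + r)) := by push_cast; ring_nf
      _ ≤ a s * a s ^ n := (hmul _ _).trans (by gcongr)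
      _ = a s ^ (n + 1) := (pow_succ' _ _).symm

/-- Fekete's lemma for a submultiplicative function bounded by `1`. -/
theorem tendsto_logRate_of_submultiplicative {a : ℝ≥0 → ℝ≥0∞} (h1 : ∀ t, a t ≤ 1)
    (hmul : ∀ s t, a (s + t) ≤ a s * a t) :
    Tendsto (fun t => logRate t (a t)) atTop (𝓝 (⨅ (s : ℝ≥0) (_ : 0 < s), logRate s (a s))) := by
  refine tendsto_of_le_liminf_of_limsup_le ?_ ?_
  · refine le_liminf_of_le (by isBoundedDefault) ?_
    filter_upwards [eventually_gt_atTop 0] with t ht using iInf₂_le t ht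
  refine le_iInf₂ fun s hs => ?_
  rw [← EReal.le_of_forall_lt_iff_le]
  intro z hz
  rcases le_or_gt 0 z with hz0 | hz0
  · refine limsup_le_of_le (by isBoundedDefault) ?_
    filter_upwards [eventually_gt_atTop 0] with t ht
    rw [logRate_le_coe_iff ht]
    refine (h1 t).trans ?_
    rw [← ENNReal.ofReal_one]
    exact ENNReal.ofReal_le_ofReal (Real.one_le_exp (by positivity))
  have hzs := (logRate_le_coe_iff hs).1 hz.le
  -- With n = ⌊t / s⌋ and z < 0, the bound t < (n + 1) s gives z n s ≤ z t - z s, which is the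
  -- source of the constant.
  refine limsup_logRate_le (C := Real.exp (-(z * s))) (Real.exp_pos _) ?_
  refine Eventually.of_forall fun t => ?_
  have hs' : (0 : ℝ) < s := hs
  set n := ⌊t / s⌋₊ with hn
  have hns : (n : ℝ≥0) * s ≤ t := by
    rw [← le_div_iff₀ hs]; exact Nat.floor_le (by positivity)
  have hlt : (t : ℝ) < (n + 1) * s := by
    have : t / s < n + 1 := Nat.lt_floor_add_one _
    rw [div_lt_iff₀ hs] at this
    exact_mod_cast this
  calc a t = a (n * s + (t - n * s)) := by rw [add_tsub_cancel_of_le hns]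
    _ ≤ a s ^ n := pow_le_of_submultiplicative h1 hmul s _ n
    _ ≤ ENNReal.ofReal (Real.exp (z * s)) ^ n := by gcongr
    _ = ENNReal.ofReal (Real.exp (n * (z * s))) := by
      rw [← ENNReal.ofReal_pow (Real.exp_pos _).le, ← Real.exp_nat_mul]
    _ ≤ _ := by
      rw [← Real.exp_add]
      refine ENNReal.ofReal_le_ofReal (Real.exp_le_exp.2 ?_)
      nlinarith

/-- Allows all estimates to be made with a positive real r in place of M; if M = 0, letting r tend
to 0 yields -∞. -/
theorem le_neg_inv_of_forall {x : EReal} {M : ℝ≥0∞} (hM : M < ∞)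
    (h : ∀ r : ℝ, 0 < r → M ≤ ENNReal.ofReal r → x ≤ ((-r⁻¹ : ℝ) : EReal)) :
    x ≤ -((M⁻¹ : ℝ≥0∞) : EReal) := by
  rcases eq_or_ne M 0 with rfl | h0
  · suffices x = ⊥ by simp [this]
    rw [EReal.eq_bot_iff_forall_lt]
    intro y
    have hpos : 0 < |y| + 1 := by positivity
    refine (h (|y| + 1)⁻¹ (inv_pos.2 hpos) zero_le).trans_lt ?_
    rw [inv_inv, EReal.coe_lt_coe_iff]
    linarith [neg_abs_le y]
  · have hr : 0 < M.toReal := ENNReal.toReal_pos h0 hM.ne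
    refine (h M.toReal hr (ENNReal.ofReal_toReal hM.ne).ge).trans_eq ?_
    rw [EReal.coe_neg, ← ENNReal.toReal_inv, EReal.coe_ennreal_toReal]
    simpa using h0

/-! ### Integral inequalities imply exponential decay -/

/-- Discrete Gronwall: with T_k a tail after index k, the hypothesis reads T_{k+1} ≤ K d_{k+1} = K
(T_k - T_{k+1}), so each step multiplies the tail by at most K / (K + 1). Using all partial sums
makes summability of d unnecessary. -/
theorem sum_tail_le {d : ℕ → ℝ} {K : ℝ} (hK : 0 < K) (h0 : d 0 ≤ 1)
    (h : ∀ k n, ∑ i ∈ Finset.range n, d (k + i + 1) ≤ K * d k) (k n : ℕ) :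
    ∑ i ∈ Finset.range n, d (k + i + 1) ≤ K * (K / (K + 1)) ^ k := by
  induction k generalizing n with
  | zero => exact (h 0 n).trans (by simpa using mul_le_mul_of_nonneg_left h0 hK.le)
  | succ k ih =>
    have h1 := ih (n + 1)
    rw [Finset.sum_range_succ'] at h1
    have h2 := h (k + 1) n
    have h3 : ∀ i, k + (i + 1) + 1 = k + 1 + i + 1 := fun i => by ring
    simp only [h3, add_zero] at h1
    set T := ∑ i ∈ Finset.range n, d (k + 1 + i + 1)
    have h4 : T * (K + 1) ≤ K * (K * (K / (K + 1)) ^ k) := by nlinarith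
    rw [← le_div_iff₀ (by positivity)] at h4
    exact h4.trans_eq (by ring)

/-- The hypothesis is the mesh 1/N form of ∫_s^∞ δ ≤ M δ(s). The tail bound with K = M N after m N
steps contains the factor (1 + 1/(M N))^(-m N), which tends to exp(-m / M). -/
theorem le_mul_exp_of_riemann_sum_le {δ : ℝ≥0 → ℝ} {M : ℝ} (hM : 0 < M) (h0 : δ 0 ≤ 1)
    (hanti : Antitone δ)
    (h : ∀ s : ℝ≥0, ∀ N n : ℕ, 0 < N →
      ∑ i ∈ Finset.range n, δ (s + (i + 1 : ℕ) / N) ≤ M * N * δ s) (m : ℕ) :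
    δ (m + 1) ≤ M * Real.exp (-(m / M)) := by
  have key : ∀ N : ℕ, δ (m + 1 : ℝ≥0) ≤ M * ((1 + M⁻¹ / (N + 1 : ℕ)) ^ (N + 1))⁻¹ ^ m := by
    intro N
    have hN : (0 : ℝ) < (N + 1 : ℕ) := by positivity
    have hN' : ((N + 1 : ℕ) : ℝ≥0) ≠ 0 := by positivity
    have h1 := sum_tail_le (d := fun k => δ (k / (N + 1 : ℕ))) (K := M * (N + 1 : ℕ))
      (by positivity) (by simpa using h0) (fun k n => by
        refine le_trans (le_of_eq ?_) (h (k / (N + 1 : ℕ)) (N + 1) n N.succ_pos)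
        refine Finset.sum_congr rfl fun i _ => ?_
        rw [← add_div, add_assoc k i 1]
        push_cast
        rfl) (m * (N + 1)) (N + 1)
    -- By monotonicity δ(m + 1) is at most its value at each of the N + 1 grid points in (m, m + 1].
    have h2 : (N + 1 : ℕ) * δ (m + 1) ≤
        ∑ i ∈ Finset.range (N + 1), δ ((m * (N + 1) + i + 1 : ℕ) / (N + 1 : ℕ)) := by
      rw [← nsmul_eq_mul]
      nth_rw 1 [← Finset.card_range (N + 1)]
      refine Finset.card_nsmul_le_sum _ _ _ fun i hi => hanti ?_
      rw [div_le_iff₀ (by positivity)]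
      have : i + 1 ≤ N + 1 := Finset.mem_range.1 hi
      have h5 : m * (N + 1) + i + 1 ≤ (m + 1) * (N + 1) := by linarith
      exact_mod_cast h5
    have h3 := h2.trans h1
    have h4 : M * (N + 1 : ℕ) / (M * (N + 1 : ℕ) + 1) = (1 + M⁻¹ / (N + 1 : ℕ))⁻¹ := by
      field_simp
    rw [h4, mul_comm m, pow_mul, inv_pow] at h3
    refine le_of_mul_le_mul_left (h3.trans_eq ?_) hN
    ring
  have hlim := (Real.tendsto_one_add_div_pow_exp M⁻¹).comp (tendsto_add_atTop_nat 1)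
  have hlim' := ((hlim.inv₀ (Real.exp_ne_zero _)).pow m).const_mul M
  refine (ge_of_tendsto' hlim' key).trans_eq ?_
  rw [← Real.exp_neg, ← Real.exp_nat_mul]
  congr 2
  ring

theorem le_mul_exp_of_riemann_sum_le_of_one_le {δ : ℝ≥0 → ℝ} {M : ℝ} (hM : 0 < M) (h0 : δ 0 ≤ 1)
    (hanti : Antitone δ)
    (h : ∀ s : ℝ≥0, ∀ N n : ℕ, 0 < N →
      ∑ i ∈ Finset.range n, δ (s + (i + 1 : ℕ) / N) ≤ M * N * δ s) {t : ℝ≥0} (ht : 1 ≤ t) :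
    δ t ≤ M * Real.exp (2 * M⁻¹) * Real.exp (-M⁻¹ * t) := by
  obtain ⟨r, rfl⟩ := exists_add_of_le ht
  have h1 : δ (1 + r) ≤ δ (⌊r⌋₊ + 1) := hanti <| by
    rw [add_comm]; gcongr; exact Nat.floor_le zero_le
  -- For t = 1 + r, ⌊r⌋ > t - 2; this is the origin of the factor exp(2 / M).
  refine h1.trans ((le_mul_exp_of_riemann_sum_le hM h0 hanti h _).trans ?_)
  rw [mul_assoc, ← Real.exp_add]
  gcongr
  have h2 : (r : ℝ) < ⌊r⌋₊ + 1 := by exact_mod_cast Nat.lt_floor_add_one r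
  have h3 : 0 < M⁻¹ := inv_pos.2 hM
  rw [div_eq_mul_inv]
  push_cast
  nlinarith

/-! ### Functions of bounded oscillation -/

section Oscillation

variable {E : Type*}

/-- The oscillation of `f` is at most `c`. -/
def OscLE (f : E → ℝ) (c : ℝ) : Prop := ∀ x y, f x - f y ≤ c

theorem oscNorm_le_ofReal_iff {f : E → ℝ} {c : ℝ} (hc : 0 ≤ c) :
    oscNorm f ≤ ENNReal.ofReal c ↔ OscLE f c := by
  simp [oscNorm, iSup_le_iff, ENNReal.ofReal_le_ofReal_iff hc, OscLE]

theorem OscLE.const_mul {f : E → ℝ} {c a : ℝ} (hf : OscLE f c) (ha : 0 ≤ a) :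
    OscLE (fun x => a * f x) (a * c) := fun x y => by
  rw [← mul_sub]; exact mul_le_mul_of_nonneg_left (hf x y) ha

theorem oscLE_indicator_one (A : Set E) : OscLE (A.indicator (1 : E → ℝ)) 1 := fun x y => by
  by_cases hx : x ∈ A <;> by_cases hy : y ∈ A <;> simp [hx, hy]

variable [MeasurableSpace E]

theorem OscLE.integrable [Nonempty E] {f : E → ℝ} {c : ℝ} (ho : OscLE f c) (hf : Measurable f)
    (μ : Measure E) [IsFiniteMeasure μ] : Integrable f μ := by
  obtain ⟨x₀⟩ := ‹Nonempty E›
  refine Integrable.of_bound hf.aestronglyMeasurable (|f x₀| + c) (Eventually.of_forall fun x => ?_)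
  rw [Real.norm_eq_abs, abs_le]
  constructor <;> linarith [ho x x₀, ho x₀ x, neg_abs_le (f x₀), le_abs_self (f x₀)]

theorem OscLE.integral_sub_integral_le [Nonempty E] {f : E → ℝ} {c : ℝ} (ho : OscLE f c)
    (hf : Measurable f) (μ ν : Measure E) [IsProbabilityMeasure μ] [IsProbabilityMeasure ν] :
    ∫ x, f x ∂μ - ∫ x, f x ∂ν ≤ c := by
  have h1 : ∀ y, ∫ x, f x ∂μ - c ≤ f y := fun y => by
    have := integral_mono (ho.integrable hf μ) (integrable_const (f y + c))
      (fun x => by linarith [ho x y])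
    simp at this
    linarith
  have := integral_mono (integrable_const (∫ x, f x ∂μ - c)) (ho.integrable hf ν) h1
  simp at this
  linarith

end Oscillation

section Transition

variable {E : Type*} [TopologicalSpace E] [MeasurableSpace E] {P : Kernel E (CadlagPath E)}

/-! ### The transition semigroup -/

theorem IsMarkovProcess.isMarkovKernel (hP : IsMarkovProcess P) : IsMarkovKernel P :=
  ⟨hP.isProbabilityMeasure⟩

instance [IsMarkovKernel P] (t : ℝ≥0) : IsMarkovKernel (transition P t) :=
  Kernel.IsMarkovKernel.map _ (measurable_coord t)

theorem transition_apply (t : ℝ≥0) (x : E) : transition P t x = (P x).map (coord t) :=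
  Kernel.map_apply _ (measurable_coord t) _

/-- Chapman–Kolmogorov: integrate the Markov property at time s over all paths. -/
theorem transition_add (hP : IsMarkovProcess P) (s t : ℝ≥0) :
    transition P (s + t) = transition P t ∘ₖ transition P s := by
  have := hP.isMarkovKernel
  ext x A hA
  rw [← ENNReal.toReal_eq_toReal_iff' (measure_ne_top _ _) (measure_ne_top _ _)]
  have hm := (canonicalFiltration E).le s
  have h1 := integral_congr_ae (hP.markov x s t A hA)
  rw [integral_condExp hm] at h1
  have hB : MeasurableSet (coord (s + t) ⁻¹' A : Set (CadlagPath E)) := measurable_coord _ hA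
  rw [integral_indicator hB] at h1
  have hmeas : Measurable fun y => transition P t y A := Kernel.measurable_coe _ hA
  rw [transition_apply, Measure.map_apply (measurable_coord _) hA, Kernel.comp_apply' _ _ _ hA,
    transition_apply s x, lintegral_map hmeas (measurable_coord s),
    ← integral_toReal (f := fun ω : CadlagPath E => transition P t (coord s ω) A)
      (hmeas.comp (measurable_coord s)).aemeasurable
      (Eventually.of_forall fun _ => measure_lt_top _ _)]
  simpa [measureReal_def] using h1

theorem semigroup_eq_integral {f : E → ℝ} (hf : Measurable f) (t : ℝ≥0) (x : E) :
    semigroup P t f x = ∫ y, f y ∂(transition P t x) := by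
  rw [transition_apply, integral_map (measurable_coord t).aemeasurable hf.aestronglyMeasurable]
  rfl

theorem measurable_semigroup [IsMarkovKernel P] {f : E → ℝ} (hf : Measurable f) (t : ℝ≥0) :
    Measurable (semigroup P t f) := by
  have : semigroup P t f = fun x => ∫ y, f y ∂(transition P t x) :=
    funext (semigroup_eq_integral hf t)
  rw [this]
  exact hf.stronglyMeasurable.integral_kernel.measurable

variable [Nonempty E]

theorem OscLE.semigroup [IsMarkovKernel P] {f : E → ℝ} {c : ℝ} (ho : OscLE f c)
    (hf : Measurable f) (t : ℝ≥0) : OscLE (semigroup P t f) c := fun x y => by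
  rw [semigroup_eq_integral hf, semigroup_eq_integral hf]
  exact ho.integral_sub_integral_le hf _ _

theorem semigroup_add (hP : IsMarkovProcess P) {f : E → ℝ} {c : ℝ} (hf : Measurable f)
    (ho : OscLE f c) (s t : ℝ≥0) : semigroup P (s + t) f = semigroup P s (semigroup P t f) := by
  have := hP.isMarkovKernel
  ext x
  rw [semigroup_eq_integral hf, semigroup_eq_integral (measurable_semigroup hf t),
    transition_add hP, Kernel.integral_comp (ho.integrable hf _)]
  simp only [semigroup_eq_integral hf]

/-! ### The oscillation distance between transition probabilities -/

/-- The largest difference of the means under `δ_x S_t` and `δ_y S_t` of a Borel function of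
oscillation at most `1`. -/
noncomputable def oscDist (P : Kernel E (CadlagPath E)) (t : ℝ≥0) (x y : E) : ℝ :=
  ⨆ f : {f : E → ℝ // Measurable f ∧ OscLE f 1}, (semigroup P t f x - semigroup P t f y)

instance : Nonempty {f : E → ℝ // Measurable f ∧ OscLE f 1} :=
  ⟨fun _ => 0, measurable_const, fun _ _ => by norm_num⟩

theorem bddAbove_oscDist [IsMarkovKernel P] (t : ℝ≥0) (x y : E) :
    BddAbove (Set.range fun f : {f : E → ℝ // Measurable f ∧ OscLE f 1} =>
      semigroup P t f x - semigroup P t f y) :=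
  ⟨1, by rintro _ ⟨f, rfl⟩; exact f.2.2.semigroup f.2.1 t x y⟩

theorem oscDist_le_one [IsMarkovKernel P] (t : ℝ≥0) (x y : E) : oscDist P t x y ≤ 1 :=
  ciSup_le fun f => f.2.2.semigroup f.2.1 t x y

theorem semigroup_sub_le [IsMarkovKernel P] {f : E → ℝ} {c : ℝ} (hf : Measurable f)
    (ho : OscLE f c) (t : ℝ≥0) (x y : E) :
    semigroup P t f x - semigroup P t f y ≤ c * oscDist P t x y := by
  have hc : 0 ≤ c := by simpa using ho x x
  rcases hc.eq_or_lt with rfl | hc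
  · simpa using ho.semigroup hf t x y
  have h1 := le_ciSup (bddAbove_oscDist (P := P) t x y)
    ⟨fun z => c⁻¹ * f z, hf.const_mul _, by
      simpa [inv_mul_cancel₀ hc.ne'] using ho.const_mul (inv_pos.2 hc).le⟩
  simp only [semigroup, integral_const_mul] at h1
  rw [← mul_sub, inv_mul_le_iff₀ hc] at h1
  exact h1

/-- S_t does not increase oscillation, so S_t f is an admissible test function at the earlier time.
-/
theorem oscDist_antitone (hP : IsMarkovProcess P) (x y : E) :
    Antitone fun t => oscDist P t x y := by
  have := hP.isMarkovKernel
  intro s u hsu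
  obtain ⟨t, rfl⟩ := exists_add_of_le hsu
  refine ciSup_le fun f => ?_
  rw [semigroup_add hP f.2.1 f.2.2]
  simpa using semigroup_sub_le (measurable_semigroup f.2.1 t) (f.2.2.semigroup f.2.1 t) s x y

theorem semigroupOscNorm_le_ofReal_iff [IsMarkovKernel P] {t : ℝ≥0} {c : ℝ} (hc : 0 ≤ c) :
    semigroupOscNorm P t ≤ ENNReal.ofReal c ↔ ∀ x y, oscDist P t x y ≤ c := by
  simp only [semigroupOscNorm, iSup_le_iff, oscNorm_le_ofReal_iff hc]
  rw [← ENNReal.ofReal_one]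
  simp only [oscNorm_le_ofReal_iff zero_le_one]
  refine ⟨fun h x y => ciSup_le fun f => h f f.2.1 f.2.2 x y, fun h f hf ho x y => ?_⟩
  exact (semigroup_sub_le hf ho t x y).trans (by simpa using h x y)

theorem semigroupOscNorm_le_one [IsMarkovKernel P] (t : ℝ≥0) : semigroupOscNorm P t ≤ 1 := by
  rw [← ENNReal.ofReal_one, semigroupOscNorm_le_ofReal_iff zero_le_one]
  exact oscDist_le_one t

theorem oscDist_le_semigroupOscNorm [IsMarkovKernel P] (t : ℝ≥0) (x y : E) :
    oscDist P t x y ≤ (semigroupOscNorm P t).toReal := by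
  refine (semigroupOscNorm_le_ofReal_iff ENNReal.toReal_nonneg).1 ?_ x y
  rw [ENNReal.ofReal_toReal (ne_top_of_le_ne_top ENNReal.one_ne_top (semigroupOscNorm_le_one t))]

theorem OscLE.semigroup_mul [IsMarkovKernel P] {f : E → ℝ} {c : ℝ} (ho : OscLE f c)
    (hf : Measurable f) (t : ℝ≥0) :
    OscLE (UniformCoupling.semigroup P t f) (c * (semigroupOscNorm P t).toReal) := fun x y =>
  (semigroup_sub_le hf ho t x y).trans <| mul_le_mul_of_nonneg_left
    (oscDist_le_semigroupOscNorm t x y) (by simpa using ho x x)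

theorem semigroupOscNorm_add_le (hP : IsMarkovProcess P) (s t : ℝ≥0) :
    semigroupOscNorm P (s + t) ≤ semigroupOscNorm P s * semigroupOscNorm P t := by
  have := hP.isMarkovKernel
  have hfin : ∀ t, semigroupOscNorm P t ≠ ∞ := fun t =>
    ne_top_of_le_ne_top ENNReal.one_ne_top (semigroupOscNorm_le_one t)
  rw [← ENNReal.ofReal_toReal (ENNReal.mul_ne_top (hfin s) (hfin t)),
    semigroupOscNorm_le_ofReal_iff ENNReal.toReal_nonneg, ENNReal.toReal_mul]
  intro x y
  refine ciSup_le fun f => ?_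
  rw [semigroup_add hP f.2.1 f.2.2]
  refine ((f.2.2.semigroup_mul f.2.1 t).semigroup_mul (measurable_semigroup f.2.1 t) s x y).trans_eq
    ?_
  ring

end Transition

/-! ### The coupling inequality -/

section Coupling

variable {E : Type*} [TopologicalSpace E]

/-- If the paths differ at the last grid point (n + 1)/N, then τ is at least that, while the sum has
n + 1 terms of size at most 1/N. Otherwise the last term vanishes and induction applies. -/
theorem sum_indicator_ne_le_couplingTime (ω : CadlagPath E × CadlagPath E) {N : ℕ} (hN : 0 < N) (n : ℕ) :
    ∑ i ∈ Finset.range n, {ω : CadlagPath E × CadlagPath E |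
      coord ((i + 1 : ℕ) / N) ω.1 ≠ coord ((i + 1 : ℕ) / N) ω.2}.indicator
        (fun _ => (N : ℝ≥0∞)⁻¹) ω ≤ couplingTime ω := by
  induction n with
  | zero => simp
  | succ n ih =>
    by_cases h : coord ((n + 1 : ℕ) / N : ℝ≥0) ω.1 = coord ((n + 1 : ℕ) / N) ω.2
    · rw [Finset.sum_range_succ, Set.indicator_of_notMem (by simpa using h), add_zero]
      exact ih
    have hle : ∀ i ∈ Finset.range (n + 1), {ω : CadlagPath E × CadlagPath E |
        coord ((i + 1 : ℕ) / N) ω.1 ≠ coord ((i + 1 : ℕ) / N) ω.2}.indicator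
          (fun _ => (N : ℝ≥0∞)⁻¹) ω ≤ (N : ℝ≥0∞)⁻¹ :=
      fun i _ => Set.indicator_apply_le' (fun _ => le_rfl) fun _ => zero_le
    refine (Finset.sum_le_card_nsmul _ _ _ hle).trans ?_
    refine le_iInf₂ fun u hu => ?_
    have hlt : ((n + 1 : ℕ) / N : ℝ≥0) ≤ u := by
      by_contra hcon
      exact h (hu _ (not_le.1 hcon).le)
    refine le_trans (le_of_eq ?_) (ENNReal.coe_le_coe.2 hlt)
    rw [Finset.card_range, nsmul_eq_mul, ENNReal.coe_div (by positivity), div_eq_mul_inv]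
    simp

variable [MeasurableSpace E] {P : Kernel E (CadlagPath E)}
  {Q : E → E → Measure (CadlagPath E × CadlagPath E)}

theorem IsCoupling.isProbabilityMeasure [IsMarkovKernel P] (hQ : IsCoupling P Q) (x y : E) :
    IsProbabilityMeasure (Q x y) := by
  have : IsProbabilityMeasure ((Q x y).map Prod.fst) := by rw [(hQ x y).1]; infer_instance
  exact Measure.isProbabilityMeasure_of_map (μ := Q x y) Prod.fst

variable [PolishSpace E] [BorelSpace E]

theorem measurableSet_coord_ne (t : ℝ≥0) :
    MeasurableSet {ω : CadlagPath E × CadlagPath E | coord t ω.1 ≠ coord t ω.2} :=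
  (measurableSet_eq_fun ((measurable_coord t).comp measurable_fst)
    ((measurable_coord t).comp measurable_snd)).compl

/-- Under the coupling, f(X¹_t) - f(X²_t) is 0 where the paths agree at time t and at most 1
elsewhere. -/
theorem IsCoupling.semigroup_sub_le [Nonempty E] [IsMarkovKernel P] (hQ : IsCoupling P Q)
    {f : E → ℝ} (hf : Measurable f) (ho : OscLE f 1) (t : ℝ≥0) (x y : E) :
    semigroup P t f x - semigroup P t f y ≤
      (Q x y).real {ω | coord t ω.1 ≠ coord t ω.2} := by
  have := hQ.isProbabilityMeasure x y
  have := nonempty_of_isProbabilityMeasure (Q x y)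
  have hft : Measurable fun ω : CadlagPath E => f (coord t ω) := hf.comp (measurable_coord t)
  have h1 : Integrable (fun ω : CadlagPath E × CadlagPath E => f (coord t ω.1)) (Q x y) :=
    OscLE.integrable (E := CadlagPath E × CadlagPath E) (c := 1) (fun _ _ => ho _ _)
      (hft.comp measurable_fst) _
  have h2 : Integrable (fun ω : CadlagPath E × CadlagPath E => f (coord t ω.2)) (Q x y) :=
    OscLE.integrable (E := CadlagPath E × CadlagPath E) (c := 1) (fun _ _ => ho _ _)
      (hft.comp measurable_snd) _
  have hx : semigroup P t f x = ∫ ω, f (coord t ω.1) ∂(Q x y) := by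
    rw [semigroup, ← (hQ x y).1,
      integral_map measurable_fst.aemeasurable hft.aestronglyMeasurable]
  have hy : semigroup P t f y = ∫ ω, f (coord t ω.2) ∂(Q x y) := by
    rw [semigroup, ← (hQ x y).2,
      integral_map measurable_snd.aemeasurable hft.aestronglyMeasurable]
  rw [hx, hy, ← integral_sub h1 h2, ← integral_indicator_one (measurableSet_coord_ne t)]
  refine integral_mono (h1.sub h2)
    ((integrable_const (1 : ℝ)).indicator (measurableSet_coord_ne t)) fun ω => ?_
  by_cases h : coord t ω.1 = coord t ω.2
  · simp [h]
  · simpa [h] using ho _ _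

theorem IsCoupling.sum_measureReal_le [IsMarkovKernel P] (hQ : IsCoupling P Q) {M : ℝ} (hM : 0 < M)
    (hQM : maxMeanCouplingTime Q ≤ ENNReal.ofReal M) {N : ℕ} (hN : 0 < N) (n : ℕ) (x y : E) :
    ∑ i ∈ Finset.range n, (Q x y).real {ω | coord ((i + 1 : ℕ) / N) ω.1 ≠
      coord ((i + 1 : ℕ) / N) ω.2} ≤ M * N := by
  have := hQ.isProbabilityMeasure x y
  -- Monotonicity of the lower integral needs no measurability of τ.
  have h1 := lintegral_mono (μ := Q x y) fun ω => sum_indicator_ne_le_couplingTime ω hN n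
  rw [lintegral_finsetSum _ fun i _ => measurable_const.indicator (measurableSet_coord_ne _)] at h1
  simp only [lintegral_indicator_const (measurableSet_coord_ne _), ← Finset.mul_sum] at h1
  have h2 := h1.trans ((le_iSup₂ (f := fun x y => ∫⁻ ω, couplingTime ω ∂(Q x y)) x y).trans hQM)
  have h3 := ENNReal.toReal_mono ENNReal.ofReal_ne_top h2
  rw [ENNReal.toReal_mul, ENNReal.toReal_sum fun _ _ => measure_ne_top _ _,
    ENNReal.toReal_ofReal hM.le, ENNReal.toReal_inv, ENNReal.toReal_natCast,
    inv_mul_le_iff₀ (by exact_mod_cast hN)] at h3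
  exact h3.trans_eq (mul_comm _ _)

theorem IsCoupling.sum_oscDist_le [Nonempty E] (hQ : IsCoupling P Q) (hP : IsMarkovProcess P)
    {M : ℝ} (hM : 0 < M) (hQM : maxMeanCouplingTime Q ≤ ENNReal.ofReal M) (x y : E) (s : ℝ≥0)
    (N n : ℕ) (hN : 0 < N) :
    ∑ i ∈ Finset.range n, oscDist P (s + (i + 1 : ℕ) / N) x y ≤ M * N * oscDist P s x y := by
  have := hP.isMarkovKernel
  refine le_of_forall_pos_le_add fun ε hε => ?_
  -- Each f_i may lose ε / (n + 1), so the n losses total at most ε, also for n = 0.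
  have hε' : 0 < ε / (n + 1) := by positivity
  choose f hf using fun i : ℕ => exists_lt_of_lt_ciSup
    (sub_lt_self (oscDist P (s + (i + 1 : ℕ) / N) x y) hε')
  set g : E → ℝ := fun z => ∑ i ∈ Finset.range n, semigroup P ((i + 1 : ℕ) / N) (f i) z with hg
  have hfm : ∀ i, Measurable (semigroup P ((i + 1 : ℕ) / N) (f i).1) := fun i =>
    measurable_semigroup (f i).2.1 _
  have hfo : ∀ i, OscLE (semigroup P ((i + 1 : ℕ) / N) (f i).1) 1 := fun i =>
    (f i).2.2.semigroup (f i).2.1 _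
  have hgm : Measurable g := Finset.measurable_fun_sum _ fun i _ => hfm i
  -- Here the couplings of all pairs u, v enter, although x and y are fixed.
  have hgo : OscLE g (M * N) := fun u v => by
    rw [hg, ← Finset.sum_sub_distrib]
    exact (Finset.sum_le_sum fun i _ => hQ.semigroup_sub_le (f i).2.1 (f i).2.2 _ u v).trans
      (hQ.sum_measureReal_le hM hQM hN n u v)
  have hsum : ∀ z, semigroup P s g z =
      ∑ i ∈ Finset.range n, semigroup P (s + (i + 1 : ℕ) / N) (f i) z := fun z => by
    rw [semigroup_eq_integral hgm, integral_finsetSum _ fun i _ => (hfo i).integrable (hfm i) _]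
    refine Finset.sum_congr rfl fun i _ => ?_
    rw [semigroup_add hP (f i).2.1 (f i).2.2, semigroup_eq_integral (hfm i)]
  have h1 := UniformCoupling.semigroup_sub_le (P := P) hgm hgo s x y
  rw [hsum, hsum, ← Finset.sum_sub_distrib] at h1
  have h2 := Finset.sum_le_sum fun i (_ : i ∈ Finset.range n) => (hf i).le
  rw [Finset.sum_sub_distrib, Finset.sum_const, Finset.card_range, nsmul_eq_mul] at h2
  have h3 : (n : ℝ) * (ε / (n + 1)) ≤ ε := by
    rw [mul_div_assoc', div_le_iff₀ (by positivity)]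
    nlinarith
  linarith

theorem IsCoupling.semigroupOscNorm_le [Nonempty E] (hQ : IsCoupling P Q)
    (hP : IsMarkovProcess P) {M : ℝ} (hM : 0 < M)
    (hQM : maxMeanCouplingTime Q ≤ ENNReal.ofReal M) {t : ℝ≥0} (ht : 1 ≤ t) :
    semigroupOscNorm P t ≤
      ENNReal.ofReal (M * Real.exp (2 * M⁻¹) * Real.exp (-M⁻¹ * t)) := by
  have := hP.isMarkovKernel
  rw [semigroupOscNorm_le_ofReal_iff (by positivity)]
  exact fun x y => le_mul_exp_of_riemann_sum_le_of_one_le hM (oscDist_le_one 0 x y)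
    (oscDist_antitone hP x y) (hQ.sum_oscDist_le hP hM hQM x y) ht

theorem IsCoupling.limsup_logRate_le [Nonempty E] (hQ : IsCoupling P Q)
    (hP : IsMarkovProcess P) (hM : maxMeanCouplingTime Q < ∞) {b : ℝ≥0 → ℝ≥0∞} {C : ℝ} (hC : 0 < C)
    (hb : ∀ t, b t ≤ ENNReal.ofReal C * semigroupOscNorm P t) :
    limsup (fun t => logRate t (b t)) atTop ≤
      -(((maxMeanCouplingTime Q)⁻¹ : ℝ≥0∞) : EReal) := by
  refine le_neg_inv_of_forall hM fun r hr hQr => ?_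
  refine UniformCoupling.limsup_logRate_le (C := C * (r * Real.exp (2 * r⁻¹))) (by positivity) ?_
  filter_upwards [eventually_ge_atTop 1] with t ht
  refine (hb t).trans ?_
  rw [mul_assoc, ENNReal.ofReal_mul hC.le]
  gcongr
  exact hQ.semigroupOscNorm_le hP hr hQr ht

end Coupling

/-! ### Uniform setwise limits of probability measures -/

section Limit

variable {E : Type*} [MeasurableSpace E]

theorem hasSum_measureReal_iUnion (μ : Measure E) [IsFiniteMeasure μ] {f : ℕ → Set E}
    (hf : ∀ i, MeasurableSet (f i)) (hd : Pairwise (Function.onFun Disjoint f)) :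
    HasSum (fun i => μ.real (f i)) (μ.real (⋃ i, f i)) := by
  have h := measure_iUnion (μ := μ) hd hf
  have hne : ∑' i, μ (f i) ≠ ∞ := h ▸ measure_ne_top _ _
  have := ENNReal.hasSum_toReal hne
  rwa [← ENNReal.tsum_toReal_eq fun _ => measure_ne_top _ _, ← h] at this

/-- A sequence of probability measures that is Cauchy in total variation converges. -/
theorem exists_isProbabilityMeasure_of_cauchy {p : ℕ → Measure E}
    [∀ n, IsProbabilityMeasure (p n)] {ε : ℕ → ℝ} (hε : Tendsto ε atTop (𝓝 0))
    (hp : ∀ n m A, MeasurableSet A → n ≤ m → |(p m).real A - (p n).real A| ≤ ε n) :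
    ∃ μ : Measure E, IsProbabilityMeasure μ ∧
      ∀ n A, MeasurableSet A → |μ.real A - (p n).real A| ≤ ε n := by
  have hlim : ∀ A, ∃ l, MeasurableSet A → Tendsto (fun n => (p n).real A) atTop (𝓝 l) := by
    intro A
    by_cases hA : MeasurableSet A
    · have : CauchySeq fun n => (p n).real A := cauchySeq_of_le_tendsto_0' ε
        (fun n m hnm => by rw [dist_comm]; exact hp n m A hA hnm) hε
      obtain ⟨l, hl⟩ := cauchySeq_tendsto_of_complete this
      exact ⟨l, fun _ => hl⟩
    · exact ⟨0, fun h => absurd h hA⟩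
  choose L hL using hlim
  have hbound : ∀ n A, MeasurableSet A → |L A - (p n).real A| ≤ ε n := fun n A hA =>
    le_of_tendsto ((hL A hA).sub_const _).abs
      ((eventually_ge_atTop n).mono fun m hm => hp n m A hA hm)
  have hnonneg : ∀ A, MeasurableSet A → 0 ≤ L A := fun A hA =>
    ge_of_tendsto' (hL A hA) fun n => measureReal_nonneg
  have hempty : L ∅ = 0 := tendsto_nhds_unique (hL ∅ .empty) (by simp)
  have huniv : L Set.univ = 1 := tendsto_nhds_unique (hL _ .univ) (by simp)
  have hsum : ∀ f : ℕ → Set E, (∀ i, MeasurableSet (f i)) →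
      Pairwise (Function.onFun Disjoint f) → HasSum (fun i => L (f i)) (L (⋃ i, f i)) := by
    intro f hf hd
    rw [hasSum_iff_tendsto_nat_of_nonneg fun i => hnonneg _ (hf i)]
    have hfin : ∀ n N, ∑ i ∈ Finset.range N, (p n).real (f i) =
        (p n).real (⋃ i ∈ Finset.range N, f i) := fun n N =>
      (measureReal_biUnion_finset (fun i _ j _ hij => hd hij) fun i _ => hf i).symm
    have hfinL : ∀ N, ∑ i ∈ Finset.range N, L (f i) = L (⋃ i ∈ Finset.range N, f i) := fun N => by
      refine tendsto_nhds_unique (tendsto_finsetSum _ fun i _ => hL _ (hf i)) ?_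
      simp only [hfin]
      exact hL _ (Finset.measurableSet_biUnion _ fun i _ => hf i)
    -- Countable additivity of the limit: the bound ε n is the same for all sets, so the limits in n
    -- and in N may be exchanged.
    refine TendstoUniformly.tendsto_of_eventually_tendsto (p := atTop)
      (F := fun n N => ∑ i ∈ Finset.range N, (p n).real (f i)) ?_
      (Eventually.of_forall fun n => (hasSum_measureReal_iUnion (p n) hf hd).tendsto_sum_nat)
      (hL _ (MeasurableSet.iUnion hf))
    rw [Metric.tendstoUniformly_iff]
    intro δ hδ
    filter_upwards [hε.eventually_lt_const hδ] with n hn N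
    rw [hfinL, hfin, Real.dist_eq]
    exact (hbound n _ (Finset.measurableSet_biUnion _ fun i _ => hf i)).trans_lt hn
  let μ : Measure E := Measure.ofMeasurable (fun A _ => ENNReal.ofReal (L A)) (by simp [hempty])
    fun f hf hd => by
      rw [← (hsum f hf hd).tsum_eq,
        ENNReal.ofReal_tsum_of_nonneg (fun i => hnonneg _ (hf i)) (hsum f hf hd).summable]
  have hμ : ∀ A, MeasurableSet A → μ A = ENNReal.ofReal (L A) := fun A hA =>
    Measure.ofMeasurable_apply A hA
  refine ⟨μ, ⟨by simp [hμ _ .univ, huniv]⟩, fun n A hA => ?_⟩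
  rw [measureReal_def, hμ A hA, ENNReal.toReal_ofReal (hnonneg A hA)]
  exact hbound n A hA

/-- Layer cake: the integral of f with values in [0, 1] is the integral over t in (0, 1] of the
measure of {f ≥ t}, so a bound uniform over sets passes to f without loss. -/
theorem integral_le_integral_add {μ ν : Measure E} [IsProbabilityMeasure μ]
    [IsProbabilityMeasure ν] {ε : ℝ} (h : ∀ A, MeasurableSet A → μ.real A ≤ ν.real A + ε)
    {f : E → ℝ} (hf : Measurable f) (h0 : ∀ x, 0 ≤ f x) (h1 : ∀ x, f x ≤ 1) :
    ∫ x, f x ∂μ ≤ ∫ x, f x ∂ν + ε := by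
  have hint : ∀ (ρ : Measure E) [IsProbabilityMeasure ρ], Integrable f ρ := fun ρ _ =>
    Integrable.of_bound hf.aestronglyMeasurable 1
      (Eventually.of_forall fun x => by rw [Real.norm_of_nonneg (h0 x)]; exact h1 x)
  have hcake : ∀ (ρ : Measure E) [IsProbabilityMeasure ρ],
      ∫ x, f x ∂ρ = ∫ t in Set.Ioc (0 : ℝ) 1, ρ.real {a | t ≤ f a} := fun ρ _ =>
    (hint ρ).integral_eq_integral_Ioc_meas_le (Eventually.of_forall h0) (Eventually.of_forall h1)
  have hmeas : ∀ (ρ : Measure E) [IsProbabilityMeasure ρ],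
      Integrable (fun t => ρ.real {a | t ≤ f a}) (volume.restrict (Set.Ioc (0 : ℝ) 1)) :=
    fun ρ _ => by
      have hanti : Antitone fun t => ρ.real {a | t ≤ f a} := fun s t hst =>
        measureReal_mono fun a (ha : t ≤ f a) => hst.trans ha
      exact Integrable.of_bound hanti.measurable.aestronglyMeasurable 1
        (Eventually.of_forall fun t => by
          rw [Real.norm_of_nonneg measureReal_nonneg]; exact measureReal_le_one)
  rw [hcake μ, hcake ν]
  have hmono := integral_mono (hmeas μ) ((hmeas ν).add (integrable_const ε))
    fun t => h _ (measurableSet_le measurable_const hf)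
  refine hmono.trans_eq ?_
  simp only [Pi.add_apply]
  rw [integral_add (hmeas ν) (integrable_const ε)]
  simp

/-- Truncating a measurable version at the essential supremum reduces the L^∞ claim to bounded Borel
functions. -/
theorem exists_measurable_bounded_ae_eq {μ : Measure E} {f : E → ℝ} (hf : MemLp f ∞ μ) :
    ∃ g : E → ℝ, Measurable g ∧ (∃ C : ℝ, 0 ≤ C ∧ ∀ x, |g x| ≤ C) ∧ f =ᵐ[μ] g := by
  set C := (eLpNormEssSup f μ).toReal with hCdef
  have hfin : eLpNormEssSup f μ ≠ ∞ := by simpa using hf.2.ne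
  obtain ⟨hm, -⟩ := hf
  have hC : 0 ≤ C := ENNReal.toReal_nonneg
  refine ⟨fun x => max (-C) (min C (hm.mk f x)),
    measurable_const.max (measurable_const.min hm.stronglyMeasurable_mk.measurable),
    ⟨C, hC, fun x => abs_le.2 ⟨le_max_left _ _, max_le (by linarith) (min_le_left _ _)⟩⟩, ?_⟩
  filter_upwards [hm.ae_eq_mk, ae_le_eLpNormEssSup (f := f) (μ := μ)] with x hx hb
  have hb' : |f x| ≤ C := by
    have := ENNReal.toReal_mono hfin hb
    simpa using this
  rw [← hx, min_eq_right (abs_le.1 hb').2, max_eq_right (abs_le.1 hb').1]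

end Limit

/-! ### The stationary distribution -/

section Stationary

variable {E : Type*} [TopologicalSpace E] [MeasurableSpace E] {P : Kernel E (CadlagPath E)}

theorem integral_bind_transition {f : E → ℝ} (hf : Measurable f) (t : ℝ≥0) (μ : Measure E)
    (hint : Integrable f (μ.bind (transition P t))) :
    ∫ y, f y ∂(μ.bind (transition P t)) = ∫ x, semigroup P t f x ∂μ := by
  have h : (transition P t ∘ₖ Kernel.const Unit μ) () = μ.bind (transition P t) := by
    rw [Kernel.comp_apply, Kernel.const_apply]
  rw [← h] at hint ⊢
  rw [Kernel.integral_comp hint]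
  simp [semigroup_eq_integral hf]

theorem semigroup_indicator_one {A : Set E} (hA : MeasurableSet A) (t : ℝ≥0) (x : E) :
    semigroup P t (A.indicator 1) x = (transition P t x).real A := by
  rw [semigroup_eq_integral (measurable_one.indicator hA), integral_indicator_one hA]

/-- S_t is well defined on classes modulo μ: as μ S_t = μ, a μ-null set is null for δ_x S_t for
μ-almost every x. -/
theorem IsStationary.semigroup_ae_eq {μ : Measure E} (hμ : IsStationary P μ) {f g : E → ℝ}
    (h : f =ᵐ[μ] g) (t : ℝ≥0) : semigroup P t f =ᵐ[μ] semigroup P t g := by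
  have h1 : ∀ᵐ x ∂μ, ∀ᵐ y ∂(transition P t x), f y = g y :=
    Measure.ae_ae_of_ae_bind (transition P t).measurable.aemeasurable (by rw [hμ.2 t]; exact h)
  filter_upwards [h1] with x hx
  rw [transition_apply] at hx
  exact integral_congr_ae (ae_of_ae_map (measurable_coord t).aemeasurable hx)

variable [Nonempty E]

/-- Since μ(f) = μ(S_t f), a value of S_t f is compared with an average of the same function. -/
theorem IsStationary.abs_semigroup_sub_integral_le [IsMarkovKernel P] {μ : Measure E}
    (hμ : IsStationary P μ) {f : E → ℝ} {c : ℝ} (hf : Measurable f) (ho : OscLE f c) (t : ℝ≥0)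
    (x : E) :
    |semigroup P t f x - ∫ y, f y ∂μ| ≤ c * (semigroupOscNorm P t).toReal := by
  have := hμ.1
  have h1 : ∫ y, f y ∂μ = ∫ y, semigroup P t f y ∂μ := by
    conv_lhs => rw [← hμ.2 t]
    exact integral_bind_transition hf t μ (by rw [hμ.2 t]; exact ho.integrable hf μ)
  have hm := measurable_semigroup (P := P) hf t
  have hs := ho.semigroup_mul (P := P) hf t
  have h2 := hs.integral_sub_integral_le hm (Measure.dirac x) μ
  have h3 := hs.integral_sub_integral_le hm μ (Measure.dirac x)
  rw [integral_dirac' _ _ hm.stronglyMeasurable] at h2 h3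
  rw [h1, abs_le]
  constructor <;> linarith

/-- S_{s+t} f(x) is the mean of S_t f under δ_x S_s. The bound is uniform in s, which makes δ_x S_n
Cauchy in total variation. -/
theorem abs_semigroup_add_sub_le (hP : IsMarkovProcess P) {f : E → ℝ} {c : ℝ} (hf : Measurable f)
    (ho : OscLE f c) (s t : ℝ≥0) (x : E) :
    |semigroup P (s + t) f x - semigroup P t f x| ≤ c * (semigroupOscNorm P t).toReal := by
  have := hP.isMarkovKernel
  have hm := measurable_semigroup (P := P) hf t
  have hs := ho.semigroup_mul (P := P) hf t
  have h2 := hs.integral_sub_integral_le hm (transition P s x) (Measure.dirac x)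
  have h3 := hs.integral_sub_integral_le hm (Measure.dirac x) (transition P s x)
  rw [integral_dirac' _ _ hm.stronglyMeasurable, ← semigroup_eq_integral hm,
    ← semigroup_add hP hf ho] at h2 h3
  rw [abs_le]
  constructor <;> linarith

theorem IsStationary.unique [IsMarkovKernel P]
    (ha : Tendsto (fun n : ℕ => (semigroupOscNorm P n).toReal) atTop (𝓝 0)) {μ ν : Measure E}
    (hμ : IsStationary P μ) (hν : IsStationary P ν) : ν = μ := by
  have := hμ.1
  have := hν.1
  obtain ⟨x⟩ := ‹Nonempty E›
  have key : ∀ ρ, IsStationary P ρ → ∀ A, MeasurableSet A →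
      Tendsto (fun n : ℕ => semigroup P n (A.indicator 1) x) atTop (𝓝 (ρ.real A)) := by
    intro ρ hρ A hA
    rw [tendsto_iff_dist_tendsto_zero]
    refine squeeze_zero (fun _ => dist_nonneg) (fun n => ?_) ha
    rw [Real.dist_eq, ← integral_indicator_one hA]
    simpa using hρ.abs_semigroup_sub_integral_le (measurable_one.indicator hA)
      (oscLE_indicator_one A) n x
  ext A hA
  rw [← measureReal_eq_measureReal_iff]
  exact tendsto_nhds_unique (key ν hν A hA) (key μ hμ A hA)

theorem exists_isStationary (hP : IsMarkovProcess P)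
    (ha : Tendsto (fun n : ℕ => (semigroupOscNorm P n).toReal) atTop (𝓝 0)) :
    ∃ μ : Measure E, IsStationary P μ := by
  have := hP.isMarkovKernel
  have hE := ‹Nonempty E›
  obtain ⟨x⟩ := hE
  have hind : ∀ A : Set E, MeasurableSet A → Measurable (A.indicator (1 : E → ℝ)) :=
    fun A hA => measurable_one.indicator hA
  obtain ⟨μ, hμ, hlim⟩ := exists_isProbabilityMeasure_of_cauchy
    (p := fun n : ℕ => transition P n x) ha fun n m A hA hnm => by
      obtain ⟨k, rfl⟩ := exists_add_of_le hnm
      rw [← semigroup_indicator_one hA, ← semigroup_indicator_one hA, add_comm n k, Nat.cast_add]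
      simpa using abs_semigroup_add_sub_le hP (hind A hA) (oscLE_indicator_one A) k n x
  refine ⟨μ, hμ, fun t => ?_⟩
  have hbind : IsProbabilityMeasure (μ.bind (transition P t)) := by infer_instance
  ext A hA
  rw [← measureReal_eq_measureReal_iff, ← sub_eq_zero, ← abs_eq_zero]
  refine le_antisymm ?_ (abs_nonneg _)
  -- Three errors, each at most the oscillation norm at time n: from μ S_t to δ_x S_{n+t}, from
  -- there to δ_x S_n, and back to μ.
  refine ge_of_tendsto' (by simpa using ha.const_mul 3) fun n : ℕ => ?_
  set g := semigroup P t (A.indicator 1) with hg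
  have hgm : Measurable g := measurable_semigroup (hind A hA) t
  have hg0 : ∀ y, 0 ≤ g y := fun y => by
    rw [hg, semigroup_indicator_one hA]; exact measureReal_nonneg
  have hg1 : ∀ y, g y ≤ 1 := fun y => by
    rw [hg, semigroup_indicator_one hA]; exact measureReal_le_one
  have e1 : (μ.bind (transition P t)).real A = ∫ y, g y ∂μ := by
    rw [← integral_indicator_one hA, integral_bind_transition (hind A hA)]
    exact (oscLE_indicator_one A).integrable (hind A hA) _
  have e2 : ∫ y, g y ∂(transition P n x) = semigroup P (t + n) (A.indicator 1) x := by
    rw [add_comm, semigroup_add hP (hind A hA) (oscLE_indicator_one A),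
      semigroup_eq_integral hgm]
  have b1 := integral_le_integral_add (μ := μ) (ν := transition P n x)
    (ε := (semigroupOscNorm P n).toReal) (fun B hB => by linarith [(abs_le.1 (hlim n B hB)).2]) hgm hg0 hg1
  have b2 := integral_le_integral_add (μ := transition P n x) (ν := μ)
    (ε := (semigroupOscNorm P n).toReal) (fun B hB => by linarith [(abs_le.1 (hlim n B hB)).1]) hgm hg0 hg1
  have b3 := abs_le.1 (abs_semigroup_add_sub_le hP (hind A hA) (oscLE_indicator_one A) t n x)
  have b4 := abs_le.1 (hlim n A hA)
  rw [semigroup_indicator_one hA n] at b3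
  rw [e2] at b1 b2
  rw [e1, abs_le]
  constructor <;> linarith [b3.1, b3.2, b4.1, b4.2]

theorem IsStationary.supNorm_semigroup_sub_le [IsMarkovKernel P] {μ : Measure E}
    (hμ : IsStationary P μ) {f : E → ℝ} {C : ℝ} (hf : Measurable f) (hC : ∀ x, |f x| ≤ C)
    (t : ℝ≥0) :
    supNorm (fun x => semigroup P t f x - ∫ y, f y ∂μ) ≤
      ENNReal.ofReal (2 * C + 1) * semigroupOscNorm P t := by
  -- The oscillation is at most 2 C; the extra 1 keeps the constant positive when C = 0.
  have ho : OscLE f (2 * C + 1) := fun x y => by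
    linarith [(abs_le.1 (hC x)).2, (abs_le.1 (hC y)).1]
  have h0 : 0 ≤ 2 * C + 1 := by
    obtain ⟨x⟩ := ‹Nonempty E›
    linarith [(abs_nonneg _).trans (hC x)]
  refine iSup_le fun x => ?_
  rw [← ENNReal.ofReal_toReal
    (ne_top_of_le_ne_top ENNReal.one_ne_top (semigroupOscNorm_le_one (P := P) t)),
    ← ENNReal.ofReal_mul h0, Real.enorm_eq_ofReal_abs]
  exact ENNReal.ofReal_le_ofReal (hμ.abs_semigroup_sub_integral_le hf ho t x)

theorem IsStationary.eLpNorm_semigroup_sub_le [IsMarkovKernel P] {μ : Measure E}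
    (hμ : IsStationary P μ) {f : E → ℝ} (hf : MemLp f ∞ μ) :
    ∃ C : ℝ, 0 < C ∧ ∀ t, eLpNorm (fun x => semigroup P t f x - ∫ y, f y ∂μ) ∞ μ ≤
      ENNReal.ofReal C * semigroupOscNorm P t := by
  obtain ⟨g, hg, ⟨C, hC0, hC⟩, hfg⟩ := exists_measurable_bounded_ae_eq hf
  refine ⟨2 * C + 1, by positivity, fun t => ?_⟩
  refine le_trans ?_ (hμ.supNorm_semigroup_sub_le hg hC t)
  rw [eLpNorm_exponent_top]
  refine eLpNormEssSup_le_of_ae_enorm_bound ?_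
  filter_upwards [hμ.semigroup_ae_eq hfg t] with x hx
  rw [hx, integral_congr_ae hfg]
  exact le_iSup (fun x => ‖semigroup P t g x - ∫ y, g y ∂μ‖ₑ) x

end Stationary

theorem IsCoupling.tendsto_semigroupOscNorm {E : Type*} [TopologicalSpace E] [PolishSpace E]
    [MeasurableSpace E] [BorelSpace E] [Nonempty E] {P : Kernel E (CadlagPath E)}
    {Q : E → E → Measure (CadlagPath E × CadlagPath E)} (hQ : IsCoupling P Q)
    (hP : IsMarkovProcess P) (hM : maxMeanCouplingTime Q < ∞) :
    Tendsto (fun n : ℕ => (semigroupOscNorm P n).toReal) atTop (𝓝 0) := by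
  -- Any positive r ≥ M suffices for convergence to 0; adding 1 covers M = 0.
  set r := (maxMeanCouplingTime Q).toReal + 1
  have hr : 0 < r := by positivity
  have hle : maxMeanCouplingTime Q ≤ ENNReal.ofReal r := by
    rw [← ENNReal.ofReal_toReal hM.ne]
    exact ENNReal.ofReal_le_ofReal (by simp [r])
  have hexp : Tendsto (fun n : ℕ => r * Real.exp (2 * r⁻¹) * Real.exp (-r⁻¹ * n)) atTop (𝓝 0) := by
    have h1 : Tendsto (fun n : ℕ => -r⁻¹ * (n : ℝ)) atTop atBot :=
      tendsto_natCast_atTop_atTop.const_mul_atTop_of_neg (by simpa using hr)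
    simpa using (Real.tendsto_exp_atBot.comp h1).const_mul (r * Real.exp (2 * r⁻¹))
  refine tendsto_of_tendsto_of_tendsto_of_le_of_le' tendsto_const_nhds hexp
    (Eventually.of_forall fun _ => ENNReal.toReal_nonneg) ?_
  filter_upwards [eventually_ge_atTop 1] with n hn
  exact ENNReal.toReal_le_of_le_ofReal (by positivity)
    (hQ.semigroupOscNorm_le hP hr hle (by exact_mod_cast hn))

end UniformCoupling

theorem mainTheorem9 {E : Type*} [TopologicalSpace E] [PolishSpace E] [MeasurableSpace E]
    [BorelSpace E] [Nonempty E]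
    (P : Kernel E (UniformCoupling.CadlagPath E)) (hP : UniformCoupling.IsMarkovProcess P)
    (Q : E → E → Measure (UniformCoupling.CadlagPath E × UniformCoupling.CadlagPath E))
    (hQ : UniformCoupling.IsCoupling P Q)
    (hM : UniformCoupling.maxMeanCouplingTime Q < ∞) :
    (∃ l : EReal,
      Tendsto (fun t : ℝ≥0 => UniformCoupling.logRate t (UniformCoupling.semigroupOscNorm P t))
        atTop (𝓝 l) ∧
      l ≤ -(((UniformCoupling.maxMeanCouplingTime Q)⁻¹ : ℝ≥0∞) : EReal)) ∧
    ∃ μ : Measure E, UniformCoupling.IsStationary P μ ∧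
      (∀ ν : Measure E, UniformCoupling.IsStationary P ν → ν = μ) ∧
      (∀ f : E → ℝ, Measurable f → (∃ C : ℝ, ∀ x, |f x| ≤ C) →
        limsup (fun t : ℝ≥0 => UniformCoupling.logRate t
            (UniformCoupling.supNorm fun x => UniformCoupling.semigroup P t f x - ∫ y, f y ∂μ))
          atTop ≤ -(((UniformCoupling.maxMeanCouplingTime Q)⁻¹ : ℝ≥0∞) : EReal)) ∧
      (∀ f : E → ℝ, MemLp f ∞ μ →
        limsup (fun t : ℝ≥0 => UniformCoupling.logRate t
            (eLpNorm (fun x => UniformCoupling.semigroup P t f x - ∫ y, f y ∂μ) ∞ μ))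
          atTop ≤ -(((UniformCoupling.maxMeanCouplingTime Q)⁻¹ : ℝ≥0∞) : EReal)) := by
  have := hP.isMarkovKernel
  have hlim := UniformCoupling.tendsto_logRate_of_submultiplicative
    (UniformCoupling.semigroupOscNorm_le_one (P := P))
    (UniformCoupling.semigroupOscNorm_add_le hP)
  refine ⟨⟨_, hlim, hlim.limsup_eq.symm.trans_le
    (hQ.limsup_logRate_le hP hM one_pos fun t => by simp)⟩, ?_⟩
  have ha := hQ.tendsto_semigroupOscNorm hP hM
  obtain ⟨μ, hμ⟩ := UniformCoupling.exists_isStationary hP ha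
  refine ⟨μ, hμ, fun ν hν => hμ.unique ha hν, fun f hf ⟨C, hC⟩ => ?_, fun f hf => ?_⟩
  · have hC0 : 0 < 2 * C + 1 := by
      linarith [(abs_nonneg _).trans (hC (Classical.arbitrary E))]
    exact hQ.limsup_logRate_le hP hM hC0 (hμ.supNorm_semigroup_sub_le hf hC)
  · obtain ⟨C, hC, hb⟩ := hμ.eLpNorm_semigroup_sub_le hf
    exact hQ.limsup_logRate_le hP hM hC hb
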